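/- A quandle is a set $Q$ with a binary operation $\ast$ such that $x\ast x=x$ for all $x\in Q$ and, for every $x\in Q$, the right multiplication $y\mapsto y\ast x$ is an automorphism of $(Q,\ast)$; homomorphisms of quandles are the maps preserving $\ast$. A quandle is commutative if $x\ast y=y\ast x$ for all $x,y$, and medial if $(x\ast y)\ast(z\ast w)=(x\ast z)\ast(y\ast w)$ for all $x,y,z,w$. Free (medial) commutative quandles are the free objects on sets in the category of (medial) commutative quandles. Let $\mathbb{D}=\mathbb{Z}[1/2]$ and, for a $\mathbb{D}$-module $M$, let $M_{\mathrm{mid}}$ be the quandle with underlying set $M$ and operation $x\ast y=\tfrac12(x+y)$. Let $X$ be a set of cardinality $n$ with $1\le n\le 3$. Then the free commutative quandle generated by $X$ is medial, and it is isomorphic to the free medial commutative quandle generated by $X$, which in turn is isomorphic to $(\mathbb{D}^{n-1})_{\mathrm{mid}}$. -/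

import Mathlib

open scoped Quandles

universe u v w

/-- A rack is commutative if its operation is commutative. A right rack operation `x ∗ y`
is written `y ◃ x` in Mathlib's (left) convention. Mediality
`(x ∗ y) ∗ (z ∗ w) = (x ∗ z) ∗ (y ∗ w)` is Mathlib's `Rack.IsAbelian`. -/
def RackIsCommutative (Q : Type*) [Rack Q] : Prop :=
  ∀ x y : Q, x ◃ y = y ◃ x

/-- Two quandles are isomorphic: there is a bijective quandle homomorphism. -/
def QuandlesIsomorphic (P Q : Type*) [Quandle P] [Quandle Q] : Prop :=
  ∃ f : P →◃ Q, Function.Bijective f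

/-! ### Free commutative and free medial commutative quandles -/

/-- Formal words in the quandle operation and its inverse operation, on letters from `X`. -/
inductive QuandleWord (X : Type u) : Type u
  | of : X → QuandleWord X
  | act : QuandleWord X → QuandleWord X → QuandleWord X
  | inv : QuandleWord X → QuandleWord X → QuandleWord X

/-- The smallest congruence on words that forces the axioms of commutative quandles and,
if the proposition `m` holds, mediality as well. -/
inductive QuandleWord.Rel (m : Prop) {X : Type u} : QuandleWord X → QuandleWord X → Prop
  | refl (a) : Rel m a a
  | symm {a b} : Rel m a b → Rel m b a
  | trans {a b c} : Rel m a b → Rel m b c → Rel m a c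
  | congr_act {a a' b b'} : Rel m a a' → Rel m b b' → Rel m (act a b) (act a' b')
  | congr_inv {a a' b b'} : Rel m a a' → Rel m b b' → Rel m (inv a b) (inv a' b')
  | self_distrib (a b c) : Rel m (act a (act b c)) (act (act a b) (act a c))
  | inv_act (a b) : Rel m (inv a (act a b)) b
  | act_inv (a b) : Rel m (act a (inv a b)) b
  | idem (a) : Rel m (act a a) a
  | comm (a b) : Rel m (act a b) (act b a)
  | medial (a b c d) : m → Rel m (act (act a b) (act c d)) (act (act a c) (act b d))

/-- The congruence `QuandleWord.Rel` as a setoid. -/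
def QuandleWord.setoid (m : Prop) (X : Type u) : Setoid (QuandleWord X) where
  r := QuandleWord.Rel m
  iseqv := ⟨.refl, .symm, .trans⟩

/-- Words modulo the axioms: the free commutative quandle if `m` is false,
the free medial commutative quandle if `m` is true. -/
def FreeCQ (m : Prop) (X : Type u) : Type u :=
  Quotient (QuandleWord.setoid m X)

namespace FreeCQ

/-- The class of a word. -/
def mk (m : Prop) {X : Type u} (a : QuandleWord X) : FreeCQ m X :=
  Quotient.mk (QuandleWord.setoid m X) a

/-- The generators. -/
def of (m : Prop) {X : Type u} (x : X) : FreeCQ m X :=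
  mk m (.of x)

instance (m : Prop) (X : Type u) : Quandle (FreeCQ m X) where
  act := Quotient.map₂ QuandleWord.act fun _ _ h _ _ h' => .congr_act h h'
  invAct := Quotient.map₂ QuandleWord.inv fun _ _ h _ _ h' => .congr_inv h h'
  self_distrib := by
    rintro ⟨a⟩ ⟨b⟩ ⟨c⟩
    exact Quotient.sound (.self_distrib a b c)
  left_inv := by
    rintro ⟨a⟩ ⟨b⟩
    exact Quotient.sound (.inv_act a b)
  right_inv := by
    rintro ⟨a⟩ ⟨b⟩
    exact Quotient.sound (.act_inv a b)
  fix := by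
    rintro ⟨a⟩
    exact Quotient.sound (.idem a)

theorem isCommutative (m : Prop) (X : Type u) : RackIsCommutative (FreeCQ m X) := by
  rintro ⟨a⟩ ⟨b⟩
  exact Quotient.sound (.comm a b)

theorem isAbelian {m : Prop} (hm : m) (X : Type u) : Rack.IsAbelian (FreeCQ m X) := by
  rintro ⟨a⟩ ⟨b⟩ ⟨c⟩ ⟨d⟩
  exact Quotient.sound (.medial a b c d hm)

/-- Evaluation of words in a quandle. -/
def eval {X : Type u} {Q : Type v} [Quandle Q] (f : X → Q) : QuandleWord X → Q
  | .of x => f x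
  | .act a b => eval f a ◃ eval f b
  | .inv a b => eval f a ◃⁻¹ eval f b

theorem eval_eq {m : Prop} {X : Type u} {Q : Type v} [Quandle Q] (hc : RackIsCommutative Q)
    (hm : m → Rack.IsAbelian Q) (f : X → Q) {a b : QuandleWord X}
    (h : QuandleWord.Rel m a b) : eval f a = eval f b := by
  induction h with
  | refl a => rfl
  | symm _ ih => exact ih.symm
  | trans _ _ ih ih' => exact ih.trans ih'
  | congr_act _ _ ih ih' => simp only [eval, ih, ih']
  | congr_inv _ _ ih ih' => simp only [eval, ih, ih']
  | self_distrib a b c => exact Shelf.self_distrib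
  | inv_act a b => exact Rack.left_inv _ _
  | act_inv a b => exact Rack.right_inv _ _
  | idem a => exact Quandle.fix
  | comm a b => exact hc _ _
  | medial a b c d h => exact hm h _ _ _ _

/-- The universal property: a map from `X` to a commutative (and, if `m` holds, medial) quandle
extends uniquely to a quandle homomorphism. -/
theorem existsUnique_lift {m : Prop} {X : Type u} {Q : Type v} [Quandle Q]
    (hc : RackIsCommutative Q) (hm : m → Rack.IsAbelian Q) (f : X → Q) :
    ∃! g : FreeCQ m X →◃ Q, ∀ x, g (of m x) = f x := by
  refine ⟨⟨Quotient.lift (eval f) fun _ _ h => eval_eq hc hm f h, ?_⟩, fun _ => rfl, ?_⟩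
  · rintro ⟨a⟩ ⟨b⟩
    rfl
  · intro g hg
    have key : ∀ a : QuandleWord X, g (mk m a) = eval f a := by
      intro a
      induction a with
      | of x => exact hg x
      | act a b iha ihb =>
        have h : g (mk m a ◃ mk m b) = g (mk m a) ◃ g (mk m b) := g.map_act
        rw [iha, ihb] at h
        exact h
      | inv a b iha ihb =>
        have h : g (mk m a ◃ mk m (.inv a b)) = g (mk m a) ◃ g (mk m (.inv a b)) := g.map_act
        have h' : mk m a ◃ mk m (.inv a b) = mk m b := Quotient.sound (.act_inv a b)
        rw [h', iha, ihb] at h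
        change g (mk m (.inv a b)) = eval f a ◃⁻¹ eval f b
        rw [h, Rack.invAct_act_eq]
    apply ShelfHom.ext
    funext q
    obtain ⟨a⟩ := q
    exact key a

end FreeCQ

/-- The free commutative quandle generated by `X`. -/
abbrev FreeCommQuandle (X : Type u) : Type u := FreeCQ False X

/-- The free medial commutative quandle generated by `X`. -/
abbrev FreeMedialCommQuandle (X : Type u) : Type u := FreeCQ True X

theorem FreeCommQuandle.universal {X : Type u} {Q : Type v} [Quandle Q]
    (hc : RackIsCommutative Q) (f : X → Q) :
    ∃! g : FreeCommQuandle X →◃ Q, ∀ x, g (FreeCQ.of False x) = f x :=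
  FreeCQ.existsUnique_lift hc False.elim f

theorem FreeMedialCommQuandle.universal {X : Type u} {Q : Type v} [Quandle Q]
    (hc : RackIsCommutative Q) (hm : Rack.IsAbelian Q) (f : X → Q) :
    ∃! g : FreeMedialCommQuandle X →◃ Q, ∀ x, g (FreeCQ.of True x) = f x :=
  FreeCQ.existsUnique_lift hc (fun _ => hm) f

/-! ### Midpoint quandles -/

/-- The midpoint quandle `M_mid` of a module `M` over a ring `R` in which `2` is invertible:
the set `M` with the operation `(1/2) (x + y)`. -/
def MidpointQuandle (R : Type v) (M : Type w) [Ring R] [Invertible (2 : R)] [AddCommGroup M]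
    [Module R M] : Type w :=
  M

instance (R : Type v) (M : Type w) [Ring R] [Invertible (2 : R)] [AddCommGroup M] [Module R M] :
    Quandle (MidpointQuandle R M) where
  act := fun (x y : M) => ((⅟2 : R) • (x + y) : M)
  invAct := fun (x y : M) => ((2 : R) • y - x : M)
  self_distrib := by
    intro (x : M) (y : M) (z : M)
    change (⅟2 : R) • (x + (⅟2 : R) • (y + z)) =
      (⅟2 : R) • ((⅟2 : R) • (x + y) + (⅟2 : R) • (x + z))
    rw [← smul_add (⅟2 : R) (x + y) (x + z)]
    congr 1
    have hx : x = (⅟2 : R) • (x + x) := by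
      rw [← two_smul R x, smul_smul, invOf_mul_self, one_smul]
    nth_rewrite 1 [hx]
    rw [← smul_add]
    congr 1
    abel
  left_inv := by
    intro (x : M) (y : M)
    change (2 : R) • ((⅟2 : R) • (x + y)) - x = y
    rw [smul_smul, mul_invOf_self, one_smul, add_sub_cancel_left]
  right_inv := by
    intro (x : M) (y : M)
    change (⅟2 : R) • (x + ((2 : R) • y - x)) = y
    rw [add_sub_cancel, smul_smul, invOf_mul_self, one_smul]
  fix := by
    intro (x : M)
    change (⅟2 : R) • (x + x) = x
    rw [← two_smul R x, smul_smul, invOf_mul_self, one_smul]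

/-- The ring `ℤ[1/2]` of dyadic rationals. -/
abbrev DyadicRing : Type := Localization.Away (2 : ℤ)

noncomputable instance : Invertible (2 : DyadicRing) where
  invOf := IsLocalization.Away.invSelf (2 : ℤ)
  invOf_mul_self := by
    have h := IsLocalization.Away.mul_invSelf (S := DyadicRing) (2 : ℤ)
    rw [mul_comm] at h
    simpa using h
  mul_invOf_self := by
    have h := IsLocalization.Away.mul_invSelf (S := DyadicRing) (2 : ℤ)
    simpa using h

/-! ### The pointed sum of a commutative quandle -/

/-! Fix an origin `o` and put x + y = `o ◃⁻¹ (x ◃ y)`. Translation by x is `o ◃⁻¹ ·` after `x ◃ ·`,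
hence a quandle endomorphism, and endomorphisms agreeing on generators coincide. So x + (y + z) = (x
+ y) + z need only be tested at generators z. With generators `o`, `a`, `b`, the laws valid in every
commutative quandle (z = `o`, z = x, z = y) give it for x, y among `a`, `b`; this bootstraps to all
x, y, and associativity yields mediality.

In the medial case + is an abelian group law with zero `o`, in which `o ◃ ·` is halving. The map to
the dyadic module sending `o` to 0 and the other generators to the standard basis is additive. It is
injective because some 2 ^ k multiple of each element is an integral combination of generators and
there is no 2-torsion. It is surjective because its image is a subgroup closed under halving. -/

namespace CommQuandle

open Rack

section Sum

variable {Q : Type*} [Quandle Q]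

/-- The sum of `x` and `y` with respect to the origin `o`: the element whose midpoint with `o`
is the midpoint of `x` and `y`. -/
def sum (o x y : Q) : Q := o ◃⁻¹ (x ◃ y)

theorem act_sum (o x y : Q) : o ◃ sum o x y = x ◃ y := Rack.right_inv _ _

theorem sum_origin (hc : RackIsCommutative Q) (o x : Q) : sum o x o = x := by
  rw [sum, hc, Rack.left_inv]

theorem sum_comm (hc : RackIsCommutative Q) (o x y : Q) : sum o x y = sum o y x := by
  rw [sum, sum, hc]

theorem sum_self (o x : Q) : sum o (o ◃ x) (o ◃ x) = x := by
  rw [sum, Quandle.fix, Rack.left_inv]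

/-- Translation by `x` for the pointed sum is an endomorphism of the quandle. -/
def translation (o x : Q) : Q →◃ Q where
  toFun := sum o x
  map_act' := by
    intro a b
    apply (Rack.left_cancel o).mp
    rw [act_sum, Shelf.self_distrib, Shelf.self_distrib (x := o), act_sum, act_sum]

theorem sum_sum_origin (hc : RackIsCommutative Q) (o x y : Q) :
    sum o x (sum o y o) = sum o (sum o x y) o := by
  rw [sum_origin hc, sum_origin hc]

theorem sum_sum_left (hc : RackIsCommutative Q) (o x y : Q) :
    sum o x (sum o y x) = sum o (sum o x y) x := by
  rw [sum_comm hc o y x, sum_comm hc]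

/-- After cancelling `o`, this is self-distributivity of `y` over `x ◃ o`, up to commutativity. -/
theorem sum_sum_right (hc : RackIsCommutative Q) (o x y : Q) :
    sum o x (sum o y y) = sum o (sum o x y) y := by
  have h : x ◃ sum o y y = sum o x y ◃ y := by
    apply (Rack.left_cancel o).mp
    rw [Shelf.self_distrib, act_sum, Quandle.fix, Shelf.self_distrib (x := o), act_sum,
      hc (o ◃ x), hc (x ◃ y), hc x y, hc o y, ← Shelf.self_distrib]
  rw [sum, h, ← sum]

/-- A midpoint of midpoints is a quarter of the total sum, which is symmetric in the middle terms.
-/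
theorem isAbelian_of_sum_assoc (hc : RackIsCommutative Q) (o : Q)
    (ha : ∀ x y z : Q, sum o x (sum o y z) = sum o (sum o x y) z) : Rack.IsAbelian Q := by
  have key : ∀ x y z w : Q, (x ◃ y) ◃ (z ◃ w) = o ◃ o ◃ sum o (sum o x y) (sum o z w) := by
    intro x y z w
    rw [act_sum, Shelf.self_distrib (x := o), act_sum, act_sum]
  intro x y z w
  rw [key, key, ← ha, ← ha, ha y, ha z, sum_comm hc o y z]

/-- Applying `o ◃ ·` twice turns associativity into mediality for `x`, `y`, `o`, `z`. -/
theorem sum_assoc (hc : RackIsCommutative Q) (hm : Rack.IsAbelian Q) (o x y z : Q) :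
    sum o (sum o x y) z = sum o x (sum o y z) := by
  apply (Rack.left_cancel o).mp
  apply (Rack.left_cancel o).mp
  rw [act_sum, act_sum, Shelf.self_distrib, Shelf.self_distrib (x := o), act_sum, act_sum,
    hm, hc x o]

/-- The abelian group structure on a medial commutative quandle with origin `o`. -/
abbrev addCommGroup (hc : RackIsCommutative Q) (hm : Rack.IsAbelian Q) (o : Q) :
    AddCommGroup Q where
  add := sum o
  zero := o
  neg x := x ◃⁻¹ o
  nsmul := @nsmulRec Q ⟨o⟩ ⟨sum o⟩
  zsmul := @zsmulRec Q ⟨o⟩ ⟨sum o⟩ ⟨fun x => x ◃⁻¹ o⟩ (@nsmulRec Q ⟨o⟩ ⟨sum o⟩)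
  add_assoc := sum_assoc hc hm o
  add_comm := sum_comm hc o
  add_zero := sum_origin hc o
  zero_add x := (sum_comm hc o o x).trans (sum_origin hc o x)
  neg_add_cancel x := by
    change sum o (x ◃⁻¹ o) x = o
    rw [sum_comm hc, sum, Rack.right_inv]
    exact (Rack.left_cancel o).mp (by rw [Rack.right_inv, Quandle.fix])

end Sum

end CommQuandle

/-! ### Three generators -/

namespace FreeCQ

open CommQuandle

theorem hom_ext {m : Prop} {X : Type u} {Q : Type v} [Quandle Q] (hc : RackIsCommutative Q)
    (hm : m → Rack.IsAbelian Q) {f g : FreeCQ m X →◃ Q} (h : ∀ x, f (of m x) = g (of m x)) :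
    f = g :=
  (existsUnique_lift hc hm fun x => g (of m x)).unique h fun _ => rfl

theorem induction_on {m : Prop} {X : Type u} {p : FreeCQ m X → Prop} (q : FreeCQ m X)
    (of : ∀ x, p (of m x)) (act : ∀ a b, p a → p b → p (a ◃ b))
    (inv : ∀ a b, p a → p b → p (a ◃⁻¹ b)) : p q := by
  obtain ⟨a⟩ := q
  change p (mk m a)
  induction a with
  | of x => exact of x
  | act a b iha ihb => exact act _ _ iha ihb
  | inv a b iha ihb => exact inv _ _ iha ihb

theorem isAbelian_of_three {X : Type u} (o a b : X) (hX : ∀ x, x = o ∨ x = a ∨ x = b) :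
    Rack.IsAbelian (FreeCommQuandle X) := by
  have hc : RackIsCommutative (FreeCommQuandle X) := isCommutative False X
  obtain ⟨O, hO⟩ : ∃ O : FreeCommQuandle X, O = of False o := ⟨_, rfl⟩
  obtain ⟨A, hA⟩ : ∃ A : FreeCommQuandle X, A = of False a := ⟨_, rfl⟩
  obtain ⟨B, hB⟩ : ∃ B : FreeCommQuandle X, B = of False b := ⟨_, rfl⟩
  -- Both sides of associativity are endomorphisms in the last argument.
  have ext : ∀ x y, sum O x (sum O y A) = sum O (sum O x y) A →
      sum O x (sum O y B) = sum O (sum O x y) B →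
      ∀ z, sum O x (sum O y z) = sum O (sum O x y) z := by
    intro x y h₁ h₂ z
    have h : (translation O x).comp (translation O y) = translation O (sum O x y) := by
      apply hom_ext hc False.elim
      intro t
      change sum O x (sum O y _) = sum O (sum O x y) _
      rcases hX t with rfl | rfl | rfl
      · rw [← hO]; exact sum_sum_origin hc O x y
      · rw [← hA]; exact h₁
      · rw [← hB]; exact h₂
    exact congrArg (fun f : FreeCommQuandle X →◃ FreeCommQuandle X => f z) h
  have hAB := ext A B (sum_sum_left hc O A B) (sum_sum_right hc O A B)
  have hBA := ext B A (sum_sum_right hc O B A) (sum_sum_left hc O B A)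
  -- Translations by `A` and `B` commute, both composites being translation by A + B.
  have swap : ∀ z, sum O A (sum O B z) = sum O B (sum O A z) := fun z => by
    rw [hAB, hBA, sum_comm hc O A B]
  -- At `B`: A + (y + B) = B + (A + y) by `swap`.
  have hA' : ∀ y z, sum O A (sum O y z) = sum O (sum O A y) z := fun y =>
    ext A y (sum_sum_left hc O A y) (by rw [sum_comm hc O y B, swap, sum_comm hc O B])
  have hB' : ∀ y z, sum O B (sum O y z) = sum O (sum O B y) z := fun y =>
    ext B y (by rw [sum_comm hc O y A, ← swap, sum_comm hc O A]) (sum_sum_left hc O B y)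
  apply isAbelian_of_sum_assoc hc O
  -- A generator whose translation associates with everything can also stand in the last place.
  have last : ∀ C : FreeCommQuandle X, (∀ y z, sum O C (sum O y z) = sum O (sum O C y) z) →
      ∀ x y, sum O x (sum O y C) = sum O (sum O x y) C := fun C hC x y => by
    rw [sum_comm hc O y C, sum_comm hc O x (sum O C y), ← hC, sum_comm hc O y x,
      sum_comm hc O C]
  exact fun x y => ext x y (last A hA' x y) (last B hB' x y)

theorem quandlesIsomorphic_of_isAbelian {X : Type u}
    (h : Rack.IsAbelian (FreeCommQuandle X)) :
    QuandlesIsomorphic (FreeCommQuandle X) (FreeMedialCommQuandle X) := by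
  obtain ⟨f, hf, -⟩ := FreeCommQuandle.universal (isCommutative True X) (of True (X := X))
  obtain ⟨g, hg, -⟩ := FreeMedialCommQuandle.universal (isCommutative False X) h
    (of False (X := X))
  have hgf : g.comp f = ShelfHom.id _ := hom_ext (isCommutative False X) False.elim fun x => by
    change g (f _) = _
    rw [hf, hg]; rfl
  have hfg : f.comp g = ShelfHom.id _ :=
    hom_ext (isCommutative True X) (fun _ => isAbelian trivial X) fun x => by
      change f (g _) = _
      rw [hg, hf]; rfl
  refine ⟨f, Function.bijective_iff_has_inverse.mpr ⟨g, fun x => ?_, fun x => ?_⟩⟩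
  · exact congrArg (fun k : FreeCommQuandle X →◃ FreeCommQuandle X => k x) hgf
  · exact congrArg (fun k : FreeMedialCommQuandle X →◃ FreeMedialCommQuandle X => k x) hfg

end FreeCQ

/-! ### Midpoint quandles -/

namespace MidpointQuandle

section Module

variable {R : Type v} {M : Type w} [Ring R] [Invertible (2 : R)] [AddCommGroup M] [Module R M]

/-- The identity map from a module to its midpoint quandle. -/
def of (R : Type v) {M : Type w} [Ring R] [Invertible (2 : R)] [AddCommGroup M] [Module R M]
    (x : M) : MidpointQuandle R M := x

/-- The identity map from a midpoint quandle to the underlying module. -/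
def toModule (x : MidpointQuandle R M) : M := x

theorem isCommutative : RackIsCommutative (MidpointQuandle R M) := fun x y => by
  change (⅟2 : R) • (x.toModule + y.toModule) = (⅟2 : R) • (y.toModule + x.toModule)
  rw [add_comm]

theorem isAbelian : Rack.IsAbelian (MidpointQuandle R M) := fun x y z w => by
  change (⅟2 : R) • ((⅟2 : R) • (x.toModule + y.toModule) + (⅟2 : R) • (z.toModule + w.toModule)) =
    (⅟2 : R) • ((⅟2 : R) • (x.toModule + z.toModule) + (⅟2 : R) • (y.toModule + w.toModule))
  rw [← smul_add, ← smul_add, add_add_add_comm]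

end Module

end MidpointQuandle

namespace DyadicRing

/-- Additive subgroups of `ℤ[1/2]`-modules that are closed under halving are closed under
scalar multiplication. -/
theorem smul_mem {M : Type*} [AddCommGroup M] [Module DyadicRing M] (S : AddSubgroup M)
    (hS : ∀ x ∈ S, (⅟2 : DyadicRing) • x ∈ S) (r : DyadicRing) {x : M} (hx : x ∈ S) :
    r • x ∈ S := by
  obtain ⟨k, z, hz⟩ : ∃ (k : ℕ) (z : ℤ), (2 : DyadicRing) ^ k * r = z := by
    obtain ⟨k, z, hz⟩ := IsLocalization.Away.surj (2 : ℤ) r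
    refine ⟨k, z, ?_⟩
    rw [mul_comm]
    simpa using hz
  have hr : r = (⅟2 : DyadicRing) ^ k * z := by
    rw [← hz, ← mul_assoc, ← mul_pow, invOf_mul_self, one_pow, one_mul]
  have hpow : ∀ (j : ℕ) (y : M), y ∈ S → ((⅟2 : DyadicRing) ^ j) • y ∈ S := by
    intro j
    induction j with
    | zero => intro y hy; simpa using hy
    | succ j ih =>
      intro y hy
      rw [pow_succ, mul_smul]
      exact ih _ (hS y hy)
  rw [hr, mul_smul]
  apply hpow
  rw [Int.cast_smul_eq_zsmul]
  exact S.zsmul_mem hx z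

theorem intCast_injective : Function.Injective (fun z : ℤ => (z : DyadicRing)) := by
  have h : Function.Injective (algebraMap ℤ DyadicRing) :=
    IsLocalization.injective DyadicRing (powers_le_nonZeroDivisors_of_noZeroDivisors two_ne_zero)
  exact fun a b hab => h (by simpa using hab)

end DyadicRing

/-! ### Free medial commutative quandles as dyadic modules -/

namespace FreeMedialCommQuandle

open CommQuandle

/-- The generator matched with `none` serves as origin, so the rank is one less than the number of
generators. -/
theorem quandlesIsomorphic_midpointQuandle {X : Type u} (n : ℕ) (e : X ≃ Option (Fin n)) :
    QuandlesIsomorphic (FreeMedialCommQuandle X)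
      (MidpointQuandle DyadicRing (Fin n → DyadicRing)) := by
  classical
  obtain ⟨h, hh, -⟩ := FreeMedialCommQuandle.universal
    (MidpointQuandle.isCommutative (R := DyadicRing) (M := Fin n → DyadicRing))
    MidpointQuandle.isAbelian
    (fun x : X => MidpointQuandle.of DyadicRing
      ((e x).elim (0 : Fin n → DyadicRing) fun i => Pi.single i 1))
  have hc : RackIsCommutative (FreeMedialCommQuandle X) := FreeCQ.isCommutative True X
  let o : FreeMedialCommQuandle X := FreeCQ.of True (e.symm none)
  let gen : Fin n → FreeMedialCommQuandle X := fun i => FreeCQ.of True (e.symm (some i))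
  have hof : ∀ x : X, FreeCQ.of True x = o ∨ ∃ i, FreeCQ.of True x = gen i := by
    intro x
    obtain ⟨y, rfl⟩ := e.symm.surjective x
    rcases y with _ | i
    · exact Or.inl rfl
    · exact Or.inr ⟨i, rfl⟩
  let _ : AddCommGroup (FreeMedialCommQuandle X) :=
    addCommGroup hc (FreeCQ.isAbelian trivial X) o
  let φ : FreeMedialCommQuandle X → (Fin n → DyadicRing) := fun q => (h q).toModule
  have φ_act : ∀ x y, φ (x ◃ y) = (⅟2 : DyadicRing) • (φ x + φ y) := fun x y => by
    change (h (x ◃ y)).toModule = _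
    rw [h.map_act]; rfl
  have two_half : ∀ x : Fin n → DyadicRing, (2 : DyadicRing) • (⅟2 : DyadicRing) • x = x :=
    fun x => by rw [smul_smul, mul_invOf_self, one_smul]
  have φ_o : φ o = 0 := by
    change (h _).toModule = _
    rw [hh]; simp; rfl
  have φ_gen : ∀ i, φ (gen i) = Pi.single i 1 := fun i => by
    change (h _).toModule = _
    rw [hh]; simp; rfl
  have φ_add : ∀ x y, φ (x + y) = φ x + φ y := by
    intro x y
    have h₁ := φ_act o (x + y)
    rw [show o ◃ (x + y) = x ◃ y from act_sum o x y, φ_act, φ_o, zero_add] at h₁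
    rw [← two_half (φ x + φ y), h₁, two_half]
  let Φ : FreeMedialCommQuandle X →+ (Fin n → DyadicRing) := ⟨⟨φ, φ_o⟩, φ_add⟩
  have half_add : ∀ q : FreeMedialCommQuandle X, (o ◃ q) + (o ◃ q) = q := sum_self o
  have two_act : ∀ x y : FreeMedialCommQuandle X, (x ◃ y) + (x ◃ y) = x + y := by
    intro x y
    have h₁ := half_add (x + y)
    rwa [show o ◃ (x + y) = x ◃ y from act_sum o x y] at h₁
  have two_inj : ∀ q : FreeMedialCommQuandle X, q + q = 0 → q = 0 := by
    intro q hq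
    have hq' : o ◃⁻¹ q = o := by
      change sum o q q = o at hq
      rwa [sum, Quandle.fix] at hq
    change q = o
    rw [← Rack.right_inv o q, hq', Quandle.fix]
  refine ⟨h, ?_, ?_⟩
  · have hint : ∀ q : FreeMedialCommQuandle X, ∃ (k : ℕ) (c : Fin n → ℤ),
        2 ^ k • q = ∑ i, c i • gen i := by
      have hsum : ∀ x y : FreeMedialCommQuandle X,
          (∃ (k : ℕ) (c : Fin n → ℤ), 2 ^ k • x = ∑ i, c i • gen i) →
          (∃ (k : ℕ) (c : Fin n → ℤ), 2 ^ k • y = ∑ i, c i • gen i) →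
          ∀ u v : ℤ, ∃ (k : ℕ) (c : Fin n → ℤ),
            2 ^ k • (u • x + v • y) = ∑ i, c i • gen i := by
        rintro x y ⟨k, c, hk⟩ ⟨l, d, hl⟩ u v
        refine ⟨k + l, fun i => 2 ^ l * u * c i + 2 ^ k * v * d i, ?_⟩
        simp only [add_smul, Finset.sum_add_distrib, mul_smul, ← Finset.smul_sum, ← hk, ← hl]
        simp only [← natCast_zsmul]
        push_cast
        module
      intro q
      induction q using FreeCQ.induction_on with
      | of x =>
        rcases hof x with hx | ⟨i, hx⟩
        · refine ⟨0, 0, ?_⟩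
          rw [hx]
          simp only [Pi.zero_apply, zero_smul, Finset.sum_const_zero, pow_zero, one_smul]
          rfl
        · refine ⟨0, Pi.single i 1, ?_⟩
          rw [hx]
          simp [Pi.single_apply]
      | act x y hx hy =>
        obtain ⟨k, c, hk⟩ := hsum x y hx hy 1 1
        refine ⟨k + 1, c, ?_⟩
        rw [← hk, pow_succ, mul_smul, two_smul, two_act, one_smul, one_smul]
      -- In the group, `x ◃⁻¹ y` is 2y - x.
      | inv x y hx hy =>
        obtain ⟨k, c, hk⟩ := hsum x y hx hy (-1) 2
        refine ⟨k, c, ?_⟩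
        rw [← hk]
        congr 1
        have h₁ := two_act x (x ◃⁻¹ y)
        rw [Rack.right_inv] at h₁
        rw [eq_neg_add_of_add_eq h₁.symm, neg_smul, one_smul, two_smul]
    have hΦ : Function.Injective Φ := by
      rw [injective_iff_map_eq_zero]
      intro q hq
      obtain ⟨k, c, hk⟩ := hint q
      have hc0 : ∀ i, c i = 0 := by
        intro i
        have h₁ := congrArg Φ hk
        rw [map_nsmul, hq, nsmul_zero, map_sum] at h₁
        simp only [map_zsmul] at h₁
        have h₂ := congrFun h₁ i
        simp only [show ∀ j, Φ (gen j) = Pi.single j 1 from φ_gen, Finset.sum_apply,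
          Pi.smul_apply, Pi.single_apply, Pi.zero_apply] at h₂
        simp at h₂
        exact DyadicRing.intCast_injective (by simpa using h₂.symm)
      simp only [hc0, zero_smul, Finset.sum_const_zero] at hk
      clear hint hq
      induction k with
      | zero => simpa using hk
      | succ k ih =>
        apply ih
        rw [pow_succ', mul_smul, two_smul] at hk
        exact two_inj _ hk
    exact hΦ
  · have hrange : ∀ y, y ∈ Φ.range := by
      have half : ∀ y ∈ Φ.range, (⅟2 : DyadicRing) • y ∈ Φ.range := by
        rintro _ ⟨q, rfl⟩
        refine ⟨o ◃ q, ?_⟩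
        change φ (o ◃ q) = _
        rw [φ_act, φ_o, zero_add]
        rfl
      intro y
      rw [← Finset.univ_sum_single y]
      refine Φ.range.sum_mem fun i _ => ?_
      have h₁ := DyadicRing.smul_mem Φ.range half (y i) ⟨gen i, φ_gen i⟩
      rwa [← Pi.single_smul, smul_eq_mul, mul_one] at h₁
    exact hrange

end FreeMedialCommQuandle

theorem corollary6p2 {X : Type u} (n : ℕ) (hn₁ : 1 ≤ n) (hn₃ : n ≤ 3) (hX : Nat.card X = n) :
    Rack.IsAbelian (FreeCommQuandle X) ∧
    QuandlesIsomorphic (FreeCommQuandle X) (FreeMedialCommQuandle X) ∧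
    QuandlesIsomorphic (FreeMedialCommQuandle X)
      (MidpointQuandle DyadicRing (Fin (n - 1) → DyadicRing)) := by
  obtain ⟨k, rfl⟩ : ∃ k, n = k + 1 := ⟨n - 1, by omega⟩
  have : Finite X := Nat.finite_of_card_ne_zero (by omega)
  let e : X ≃ Fin (k + 1) := Finite.equivFinOfCardEq hX
  have hab : Rack.IsAbelian (FreeCommQuandle X) := by
    -- `Fin.ofNat` reduces modulo `k + 1`, so with fewer than three generators some are listed
    -- repeatedly, which is harmless.
    let g : ℕ → X := fun i => e.symm (Fin.ofNat (k + 1) i)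
    refine FreeCQ.isAbelian_of_three (g 0) (g 1) (g 2) fun x => ?_
    have hx : x = g (e x) := by simp [g]
    have hlt : (e x : ℕ) < 3 := by omega
    generalize (e x : ℕ) = j at hx hlt
    subst hx
    interval_cases j <;> simp
  exact ⟨hab, FreeCQ.quandlesIsomorphic_of_isAbelian hab,
    FreeMedialCommQuandle.quandlesIsomorphic_midpointQuandle k (e.trans (finSuccEquiv k))⟩
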